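/- Lemma 3.3. There is an absolute constant $c$ with the following property. Let $R,a>0$, $\Omega=(0,R)\times(-a,a)$ and $dx=r\,dr\,dz$. Let $\psi_1=\psi_1(r,z)$ be $2a$-periodic in $z$, continuous on $[0,R]\times\mathbb R$ and three times continuously differentiable on $(0,R)\times\mathbb R$, and suppose that $$-\psi_{1,rr}-\psi_{1,zz}-\frac3r\,\psi_{1,r}=\omega_1\quad\text{in }\Omega,\qquad \psi_1|_{r=R}=0,\qquad \psi_1|_{r=0}=0 .$$ Then $$\int_\Omega\frac{\psi_{1,zz}^2}{r^2}\,dx+\int_\Omega\Big(\psi_{1,zrr}^2+\frac{\psi_{1,zr}^2}{r^2}+\frac{\psi_{1,z}^2}{r^4}\Big)dx\le c\int_\Omega\omega_{1,z}^2\,dx .$$ Here both sides take values in $[0,\infty]$; in particular, the integrals on the left are finite whenever $\omega_{1,z}\in L_2(\Omega)$. -/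

import Mathlib

open Set MeasureTheory
open scoped ENNReal NNReal

namespace StreamFunction

/-- Partial derivative in the radial variable of a function of `(r, z)`. -/
noncomputable def dr (f : ℝ × ℝ → ℝ) (p : ℝ × ℝ) : ℝ :=
  deriv (fun r : ℝ => f (r, p.2)) p.1

/-- Partial derivative in the axial variable of a function of `(r, z)`. -/
noncomputable def dz (f : ℝ × ℝ → ℝ) (p : ℝ × ℝ) : ℝ :=
  deriv (fun z : ℝ => f (p.1, z)) p.2

/-- The meridian domain `Ω = (0, R) × (-a, a)`. -/
def Omega (R a : ℝ) : Set (ℝ × ℝ) := Ioo 0 R ×ˢ Ioo (-a) a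

/-- The integral over `Ω` of a nonnegative axially symmetric function with respect to
`dx = r dr dz`, as an extended nonnegative number. -/
noncomputable def integralOmega (R a : ℝ) (f : ℝ × ℝ → ℝ) : ℝ≥0∞ :=
  ∫⁻ p in Omega R a, ENNReal.ofReal (f p * p.1)

/-- `ψ` is a classical solution of
`-ψ_rr - ψ_zz - (3/r) ψ_r = ω` in `Ω`, `ψ = 0` at `r = R`, `ψ` periodic in `z` with period `2a`.
Regularity: three times continuously differentiable for `0 < r < R` (across the identified ends
`z = ± a` as well) and continuous up to `r = 0` and `r = R`. No bound on derivatives near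
the axis or near the lateral boundary is required. -/
structure IsRegularSolution (R a : ℝ) (ψ ω : ℝ × ℝ → ℝ) : Prop where
  contDiffOn : ContDiffOn ℝ 3 ψ (Ioo 0 R ×ˢ univ)
  continuousOn : ContinuousOn ψ (Icc 0 R ×ˢ univ)
  periodic : ∀ r ∈ Icc 0 R, ∀ z : ℝ, ψ (r, z + 2 * a) = ψ (r, z)
  lateral : ∀ z : ℝ, ψ (R, z) = 0
  equation : ∀ p ∈ Omega R a,
    -dr (dr ψ) p - dz (dz ψ) p - 3 / p.1 * dr ψ p = ω p

end StreamFunction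

/-!
Only axial derivatives of `ψ` occur in the estimate, so the problem is expanded into a Fourier
series in `z`. With `u = ψ_z`, differentiating the equation gives
`-u_rr - u_zz - (3/r) u_r = ω_z`, and a Fourier coefficient `v(r)` of `u` at frequency `λ` solves
`-v'' - (3/r) v' + λ² v = g`, where `g` is the coefficient of `ω_z`. Up to the factor `λ`, `v` is a
coefficient of `ψ` itself, hence continuous up to `r = 0` and `r = R` and zero there.

The radial estimate `lintegral_density_le` bounds `λ² v² / r² + v''² + v'² / r² + v² / r⁴` in
`L¹(r dr)` by `400 ‖g‖²`, uniformly in `λ` and `R`. In the variables `w = v / r`, `p = r w'` one has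
`r p' + 4 p + 3 w - λ² r² w = -r g`; the multiplier `p` controls `p` and `λ r w`, the multiplier `w`
then controls `w`, and the multiplier `λ² r² w` controls `λ² r² w`. The three are combined into one
function `energy` whose derivative satisfies the pointwise inequality `energy_ineq`. The boundary
terms are harmless: at `r = R` the energy is bounded below by a quantity that tends to zero, and at
`r = 0` it tends to zero because `v' → 0` there (`tendsto_deriv_zero`): the boundary condition on the
axis excludes the singular solution, and `g ∈ L²(r dr)` does the rest.

Parseval's identity at each fixed `r` (`hasSum_freqDensity`, `hasSum_freqSq`) and Tonelli's theorem
(`lintegral_Omega_eq_tsum`) turn both sides of the claim into sums over the frequencies, which are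
compared term by term.
-/

namespace StreamFunction

/-! ### Partial derivatives on the strip -/

theorem isOpen_strip (R : ℝ) : IsOpen (Ioo 0 R ×ˢ (univ : Set ℝ)) := isOpen_Ioo.prod isOpen_univ

theorem dr_eq_fderiv {F : ℝ × ℝ → ℝ} {p : ℝ × ℝ} (h : DifferentiableAt ℝ F p) :
    dr F p = fderiv ℝ F p (1, 0) := by
  have h1 : HasFDerivAt F (fderiv ℝ F p) (p.1, p.2) := h.hasFDerivAt
  exact (h1.comp_hasDerivAt p.1 ((hasDerivAt_id p.1).prodMk (hasDerivAt_const p.1 p.2))).deriv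

theorem dz_eq_fderiv {F : ℝ × ℝ → ℝ} {p : ℝ × ℝ} (h : DifferentiableAt ℝ F p) :
    dz F p = fderiv ℝ F p (0, 1) := by
  have h1 : HasFDerivAt F (fderiv ℝ F p) (p.1, p.2) := h.hasFDerivAt
  exact (h1.comp_hasDerivAt p.2 ((hasDerivAt_const p.2 p.1).prodMk (hasDerivAt_id p.2))).deriv

theorem hasDerivAt_dr {F : ℝ × ℝ → ℝ} {r z : ℝ} (h : DifferentiableAt ℝ F (r, z)) :
    HasDerivAt (fun s => F (s, z)) (dr F (r, z)) r := by
  have h1 := h.hasFDerivAt.comp_hasDerivAt r ((hasDerivAt_id r).prodMk (hasDerivAt_const r z))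
  exact h1.differentiableAt.hasDerivAt

theorem hasDerivAt_dz {F : ℝ × ℝ → ℝ} {r z : ℝ} (h : DifferentiableAt ℝ F (r, z)) :
    HasDerivAt (fun s => F (r, s)) (dz F (r, z)) z := by
  have h1 := h.hasFDerivAt.comp_hasDerivAt z ((hasDerivAt_const z r).prodMk (hasDerivAt_id z))
  exact h1.differentiableAt.hasDerivAt

section Strip

variable {S : Set (ℝ × ℝ)} {F G : ℝ × ℝ → ℝ}

theorem differentiableAt_of_contDiffOn {n : ℕ} (hS : IsOpen S)
    (hF : ContDiffOn ℝ (n + 1) F S) {p : ℝ × ℝ} (hp : p ∈ S) : DifferentiableAt ℝ F p :=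
  (hF.contDiffAt (hS.mem_nhds hp)).differentiableAt (by simp)

theorem contDiffOn_dr {n : ℕ} (hS : IsOpen S) (hF : ContDiffOn ℝ (n + 1) F S) :
    ContDiffOn ℝ n (dr F) S :=
  ((hF.fderiv_of_isOpen hS le_rfl).clm_apply contDiffOn_const).congr fun _ hp =>
    dr_eq_fderiv (differentiableAt_of_contDiffOn hS hF hp)

theorem contDiffOn_dz {n : ℕ} (hS : IsOpen S) (hF : ContDiffOn ℝ (n + 1) F S) :
    ContDiffOn ℝ n (dz F) S :=
  ((hF.fderiv_of_isOpen hS le_rfl).clm_apply contDiffOn_const).congr fun _ hp =>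
    dz_eq_fderiv (differentiableAt_of_contDiffOn hS hF hp)

theorem dr_congr (hS : IsOpen S) (h : EqOn F G S) : EqOn (dr F) (dr G) S := by
  intro p hp
  have hc : ContinuousAt (fun s : ℝ => (s, p.2)) p.1 := by fun_prop
  refine Filter.EventuallyEq.deriv_eq ?_
  filter_upwards [hc.preimage_mem_nhds (hS.mem_nhds hp)] with s hs using h hs

theorem dz_congr (hS : IsOpen S) (h : EqOn F G S) : EqOn (dz F) (dz G) S := by
  intro p hp
  have hc : ContinuousAt (fun s : ℝ => (p.1, s)) p.2 := by fun_prop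
  refine Filter.EventuallyEq.deriv_eq ?_
  filter_upwards [hc.preimage_mem_nhds (hS.mem_nhds hp)] with s hs using h hs

/-- Mixed partial derivatives of a `C²` function commute. -/
theorem dz_dr_comm (hS : IsOpen S) (hF : ContDiffOn ℝ 2 F S) :
    EqOn (dz (dr F)) (dr (dz F)) S := by
  intro p hp
  have hF' : ContDiffOn ℝ ((1 : ℕ) + 1) F S := by norm_num; exact hF
  have hd : DifferentiableAt ℝ (fderiv ℝ F) p :=
    ((hF'.fderiv_of_isOpen hS le_rfl).contDiffAt (hS.mem_nhds hp)).differentiableAt (by simp)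
  have key : ∀ v w : ℝ × ℝ, fderiv ℝ (fun q => fderiv ℝ F q v) p w
      = fderiv ℝ (fderiv ℝ F) p w v := by
    intro v w
    rw [fderiv_clm_apply hd (differentiableAt_const v)]
    simp
  have e1 : dz (dr F) p = fderiv ℝ (fderiv ℝ F) p (0, 1) (1, 0) := by
    rw [dz_congr hS (fun q hq => dr_eq_fderiv (differentiableAt_of_contDiffOn hS hF' hq)) hp,
      dz_eq_fderiv (hd.clm_apply (differentiableAt_const _)), key]
  have e2 : dr (dz F) p = fderiv ℝ (fderiv ℝ F) p (1, 0) (0, 1) := by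
    rw [dr_congr hS (fun q hq => dz_eq_fderiv (differentiableAt_of_contDiffOn hS hF' hq)) hp,
      dr_eq_fderiv (hd.clm_apply (differentiableAt_const _)), key]
  rw [e1, e2]
  exact (hF.contDiffAt (hS.mem_nhds hp)).isSymmSndFDerivAt (by simp) _ _

end Strip

theorem dz_periodic {F : ℝ × ℝ → ℝ} {r T : ℝ} (h : ∀ z, F (r, z + T) = F (r, z)) (z : ℝ) :
    dz F (r, z + T) = dz F (r, z) := by
  have e : (fun s => F (r, s)) = fun s => F (r, s + T) := funext fun s => (h s).symm
  change deriv (fun s => F (r, s)) (z + T) = deriv (fun s => F (r, s)) z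
  conv_rhs => rw [e]
  exact (deriv_comp_add_const (fun s => F (r, s)) T z).symm

/-! ### The radial energy estimate -/

open Filter Topology

/-- The energy of the radial equation `-v'' - (3/r) v' + μ v = g`, as a function of the radius `r`
and of the values `v`, `v' = v₁` at `r`. In terms of `w = v / r` and `p = r w' = v₁ - w` it is
`40 (5 (p² / 2 + 3 w² / 2 - μ v² / 2) + w p - μ r v p)`, the combination of the multipliers
`p`, `w` and `μ r² w` for which `energy_ineq` holds. -/
noncomputable def energy (μ r v v₁ : ℝ) : ℝ :=
  40 * (5 * ((v₁ - v / r) ^ 2 / 2 + 3 / 2 * (v / r) ^ 2 - μ * v ^ 2 / 2)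
    + v / r * (v₁ - v / r) - μ * (r * v * (v₁ - v / r)))

/-- The radial density of the left-hand side of the estimate for one Fourier mode. -/
noncomputable def density (μ r v v₁ v₂ : ℝ) : ℝ :=
  (μ * v ^ 2 / r ^ 2 + (v₂ ^ 2 + v₁ ^ 2 / r ^ 2 + v ^ 2 / r ^ 4)) * r

theorem density_nonneg {μ r : ℝ} (hμ : 0 ≤ μ) (hr : 0 ≤ r) (v v₁ v₂ : ℝ) :
    0 ≤ density μ r v v₁ v₂ := by
  unfold density; positivity

/-- The inequality `density + energy' ≤ 400 g² r` after multiplication by `r`, with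
`h = r g`, `k = μ r² w` and `n = μ r²`. -/
theorem energy_quadratic_ineq (w p h k n : ℝ) (hn : 0 ≤ n) (hk : k = n * w) :
    (k * w + ((k - h - 3 * p - 3 * w) ^ 2 + (p + w) ^ 2 + w ^ 2))
      + 40 * (5 * (-(4 * p ^ 2 + k * w + h * p)) + (p ^ 2 - h * w - 4 * (p * w) - 3 * w ^ 2 + k * w)
        - n * p ^ 2 - k ^ 2 + 2 * (k * p) + 3 * (k * w) + h * k) ≤ 400 * h ^ 2 := by
  have h1 : 0 ≤ k * w := by rw [hk]; nlinarith [sq_nonneg w]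
  have h2 : 0 ≤ n * p ^ 2 := by positivity
  have e1 : (k - h - 3 * p - 3 * w) ^ 2 ≤ 4 * (k ^ 2 + h ^ 2 + 9 * p ^ 2 + 9 * w ^ 2) := by
    nlinarith [sq_nonneg (k + h), sq_nonneg (k + 3 * p), sq_nonneg (k + 3 * w),
      sq_nonneg (h - 3 * p), sq_nonneg (h - 3 * w), sq_nonneg (p - w)]
  have e2 : (p + w) ^ 2 ≤ 2 * p ^ 2 + 2 * w ^ 2 := by nlinarith [sq_nonneg (p - w)]
  nlinarith [sq_nonneg (5 * h + 2 * p), sq_nonneg (h + w), sq_nonneg (2 * p + w),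
    sq_nonneg (k - 2 * p), sq_nonneg (2 * h - k), sq_nonneg p, sq_nonneg w, sq_nonneg k,
    sq_nonneg h]

/-- The derivative of the energy along a solution of the radial equation controls the density. -/
theorem energy_ineq {μ r : ℝ} (hμ : 0 ≤ μ) (hr : 0 < r) {v v₁ : ℝ → ℝ} {v₂ : ℝ}
    (h1 : HasDerivAt v (v₁ r) r) (h2 : HasDerivAt v₁ v₂ r) :
    ∃ D, HasDerivAt (fun s => energy μ s (v s) (v₁ s)) D r ∧
      density μ r (v r) (v₁ r) v₂ + D ≤ 400 * ((-v₂ - 3 / r * v₁ r + μ * v r) ^ 2 * r) := by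
  have hw := h1.div (hasDerivAt_id r) hr.ne'
  have hp := h2.sub hw
  have hE := (((((hp.pow 2).div_const 2).add ((hw.pow 2).const_mul (3 / 2))).sub
    (((h1.pow 2).const_mul μ).div_const 2)).const_mul 5 |>.add (hw.mul hp) |>.sub
    ((((hasDerivAt_id r).mul h1).mul hp).const_mul μ)).const_mul 40
  refine ⟨_, hE, ?_⟩
  obtain ⟨w, hwv⟩ : ∃ w, v r = r * w := ⟨v r / r, by field_simp⟩
  obtain ⟨p, hpv⟩ : ∃ p, v₁ r = p + w := ⟨v₁ r - w, by ring⟩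
  obtain ⟨g, hg⟩ : ∃ g, v₂ = μ * (r * w) - g - 3 / r * (p + w) :=
    ⟨μ * (r * w) - v₂ - 3 / r * (p + w), by ring⟩
  have key := energy_quadratic_ineq w p (r * g) (μ * r ^ 2 * w) (μ * r ^ 2) (by positivity) rfl
  unfold density
  simp only [id, Pi.div_apply, Pi.sub_apply, Pi.mul_apply, hwv, hpv]
  subst hg
  refine le_of_mul_le_mul_left ?_ hr
  refine le_trans (le_of_eq ?_) (key.trans (le_of_eq ?_))
  · field_simp
    ring
  · field_simp
    ring

section Radial

variable {R μ : ℝ} {v v₁ v₂ : ℝ → ℝ}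

theorem continuousOn_rhs (h1 : ∀ r ∈ Ioo 0 R, HasDerivAt v (v₁ r) r)
    (h2 : ∀ r ∈ Ioo 0 R, HasDerivAt v₁ (v₂ r) r) (hc : ContinuousOn v₂ (Ioo 0 R)) :
    ContinuousOn (fun r => -v₂ r - 3 / r * v₁ r + μ * v r) (Ioo 0 R) := by
  have c0 : ContinuousOn v (Ioo 0 R) := fun r hr => (h1 r hr).continuousAt.continuousWithinAt
  have c1 : ContinuousOn v₁ (Ioo 0 R) := fun r hr => (h2 r hr).continuousAt.continuousWithinAt
  exact ((hc.neg.sub ((continuousOn_const.div continuousOn_id fun r hr => hr.1.ne').mul c1)).add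
    (continuousOn_const.mul c0))

theorem continuousOn_density (h1 : ∀ r ∈ Ioo 0 R, HasDerivAt v (v₁ r) r)
    (h2 : ∀ r ∈ Ioo 0 R, HasDerivAt v₁ (v₂ r) r) (hc : ContinuousOn v₂ (Ioo 0 R)) :
    ContinuousOn (fun r => density μ r (v r) (v₁ r) (v₂ r)) (Ioo 0 R) := by
  have c0 : ContinuousOn v (Ioo 0 R) := fun r hr => (h1 r hr).continuousAt.continuousWithinAt
  have c1 : ContinuousOn v₁ (Ioo 0 R) := fun r hr => (h2 r hr).continuousAt.continuousWithinAt
  unfold density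
  have i2 : ∀ n : ℕ, ∀ r ∈ Ioo 0 R, r ^ n ≠ 0 := fun n r hr => (pow_pos hr.1 n).ne'
  exact (((continuousOn_const.mul (c0.pow 2)).div (continuousOn_id.pow 2) (i2 2)).add
    (((hc.pow 2).add ((c1.pow 2).div (continuousOn_id.pow 2) (i2 2))).add
      ((c0.pow 2).div (continuousOn_id.pow 4) (i2 4)))).mul continuousOn_id

/-- The flux `r³ v'` of a solution which vanishes on the axis is small along some sequence of radii,
by the mean value theorem. -/
theorem exists_flux_lt (h1 : ∀ r ∈ Ioo 0 R, HasDerivAt v (v₁ r) r)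
    (h0 : Tendsto v (𝓝[>] 0) (𝓝 0)) {ρ η : ℝ} (hρ : ρ ∈ Ioo 0 R) (hη : 0 < η) :
    ∃ ξ ∈ Ioo 0 ρ, |ξ ^ 3 * v₁ ξ| < η := by
  have hη' : 0 < η / (4 * ρ ^ 2) := by have := hρ.1; positivity
  obtain ⟨b, hb, hb'⟩ := mem_nhdsGT_iff_exists_Ioo_subset.1
    (h0 (Metric.ball_mem_nhds 0 hη'))
  simp only [mem_Ioi] at hb
  set x := min ρ b / 2 with hx
  have hm : 0 < min ρ b := lt_min hρ.1 hb
  have hxρ : x < ρ := by have := min_le_left ρ b; linarith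
  have hxb : x < b := by have := min_le_right ρ b; linarith
  have hx0 : 0 < x := by linarith
  have hsub : ∀ y ∈ Icc (x / 2) x, y ∈ Ioo 0 R := fun y hy =>
    ⟨by linarith [hy.1], by linarith [hy.2, hρ.2]⟩
  obtain ⟨ξ, hξ, hξ'⟩ := exists_hasDerivAt_eq_slope v v₁ (half_lt_self hx0)
    (fun y hy => (h1 y (hsub y hy)).continuousAt.continuousWithinAt)
    (fun y hy => h1 y (hsub y (Ioo_subset_Icc_self hy)))
  have a1 : |v x| < η / (4 * ρ ^ 2) := by
    simpa using hb' ⟨hx0, hxb⟩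
  have a2 : |v (x / 2)| < η / (4 * ρ ^ 2) := by
    simpa using hb' (⟨by linarith, by linarith⟩ : x / 2 ∈ Ioo 0 b)
  have hξ0 : 0 < ξ := by linarith [hξ.1]
  refine ⟨ξ, ⟨hξ0, hξ.2.trans hxρ⟩, ?_⟩
  have a3 : |v x - v (x / 2)| < η / (2 * ρ ^ 2) := by
    calc _ ≤ |v x| + |v (x / 2)| := abs_sub _ _
      _ < η / (4 * ρ ^ 2) + η / (4 * ρ ^ 2) := add_lt_add a1 a2
      _ = _ := by field_simp; norm_num
  have e : ξ ^ 3 * v₁ ξ = (ξ ^ 3 * 2 / x) * (v x - v (x / 2)) := by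
    rw [hξ']; field_simp; ring
  have hρ0 := hρ.1
  have hfac : ξ ^ 3 * 2 / x ≤ 2 * ρ ^ 2 := by
    rw [div_le_iff₀ hx0]
    have : ξ ^ 2 ≤ ρ ^ 2 := by gcongr; exact (hξ.2.trans hxρ).le
    nlinarith [hξ.2, mul_le_mul this hξ.2.le hξ0.le (by positivity : 0 ≤ ρ ^ 2)]
  rw [e, abs_mul, abs_of_pos (by positivity : 0 < ξ ^ 3 * 2 / x)]
  calc _ ≤ 2 * ρ ^ 2 * |v x - v (x / 2)| := by gcongr
    _ < 2 * ρ ^ 2 * (η / (2 * ρ ^ 2)) := by gcongr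
    _ = η := by field_simp

/-- A solution of the radial equation with square integrable right-hand side which vanishes on the
axis has vanishing derivative there. This is where the second solution, singular like `r⁻²`, is
excluded. -/
theorem tendsto_deriv_zero (hR : 0 < R) (h1 : ∀ r ∈ Ioo 0 R, HasDerivAt v (v₁ r) r)
    (h2 : ∀ r ∈ Ioo 0 R, HasDerivAt v₁ (v₂ r) r) (hc : ContinuousOn v₂ (Ioo 0 R))
    (h0 : Tendsto v (𝓝[>] 0) (𝓝 0)) (hμ : 0 ≤ μ)
    (hg : IntegrableOn (fun r => (-v₂ r - 3 / r * v₁ r + μ * v r) ^ 2 * r) (Ioo 0 R)) :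
    Tendsto v₁ (𝓝[>] 0) (𝓝 0) := by
  set g : ℝ → ℝ := fun r => -v₂ r - 3 / r * v₁ r + μ * v r with hgdef
  have cg : ContinuousOn g (Ioo 0 R) := continuousOn_rhs h1 h2 hc
  have c0 : ContinuousOn v (Ioo 0 R) := fun r hr => (h1 r hr).continuousAt.continuousWithinAt
  have hg' : IntegrableOn (fun r => g r ^ 2 * r) (uIcc 0 R) := by
    rw [uIcc_of_le hR.le, integrableOn_Icc_iff_integrableOn_Ioo]; exact hg
  -- The mass of the right-hand side near the axis.
  set Γ : ℝ → ℝ := fun ρ => ∫ r in (0 : ℝ)..ρ, g r ^ 2 * r with hΓ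
  have hΓ0 : Tendsto Γ (𝓝[>] 0) (𝓝 0) := by
    have := (intervalIntegral.continuousOn_primitive_interval hg') 0 left_mem_uIcc
    have h3 : Tendsto Γ (𝓝[uIcc 0 R] 0) (𝓝 (Γ 0)) := this
    rw [show Γ 0 = 0 by simp [hΓ]] at h3
    refine h3.mono_left ?_
    rw [← nhdsWithin_Ioo_eq_nhdsGT hR, uIcc_of_le hR.le]
    exact nhdsWithin_mono _ Ioo_subset_Icc_self
  have hflux : ∀ r ∈ Ioo 0 R, HasDerivAt (fun s => s ^ 3 * v₁ s) (r ^ 3 * (μ * v r - g r)) r := by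
    intro r hr
    have h3 := (hasDerivAt_pow 3 r).mul (h2 r hr)
    refine h3.congr_deriv ?_
    have := hr.1.ne'
    simp only [hgdef, Nat.cast_ofNat]
    field_simp
    ring
  -- Young's inequality with weight `ρ³ / ε` on the source term.
  have main : ∀ ε > 0, ∀ ρ ∈ Ioo 0 R, (∀ r ∈ Ioc 0 ρ, |v r| ≤ 1) →
      |v₁ ρ| ≤ ρ * μ + (Γ ρ / (2 * ε) + ε / 2) := by
    intro ε hε ρ hρ hv
    have hρ0 := hρ.1
    have step : |ρ ^ 3 * v₁ ρ| ≤ ρ ^ 3 * (ρ * μ + (Γ ρ / (2 * ε) + ε / 2)) := by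
      refine le_of_forall_pos_le_add fun η hη => ?_
      obtain ⟨ξ, hξ, hξη⟩ := exists_flux_lt h1 h0 hρ hη
      have hsub : Icc ξ ρ ⊆ Ioo 0 R := fun r hr => ⟨hξ.1.trans_le hr.1, hr.2.trans_lt hρ.2⟩
      have hu : uIcc ξ ρ = Icc ξ ρ := uIcc_of_le hξ.2.le
      have cF : ContinuousOn (fun r => r ^ 3 * (μ * v r - g r)) (uIcc ξ ρ) := by
        rw [hu]
        exact ((continuousOn_pow 3).mul ((continuousOn_const.mul c0).sub cg)).mono hsub
      have hint := intervalIntegral.integral_eq_sub_of_hasDerivAt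
        (fun r hr => hflux r (hsub (hu ▸ hr))) cF.intervalIntegrable
      have iG : IntervalIntegrable (fun r => g r ^ 2 * r) volume ξ ρ := by
        refine ContinuousOn.intervalIntegrable ?_
        rw [hu]
        exact ((cg.pow 2).mul continuousOn_id).mono hsub
      set B : ℝ → ℝ := fun r => ρ ^ 3 / (2 * ε) * (g r ^ 2 * r) + (ρ ^ 3 * μ + ε * ρ ^ 2 / 2)
      have iB : IntervalIntegrable B volume ξ ρ :=
        (iG.const_mul _).add intervalIntegrable_const
      have hb := intervalIntegral.norm_integral_le_of_norm_le (f := fun r => r ^ 3 * (μ * v r - g r))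
        (g := B) hξ.2.le (μ := volume) (by
          refine ae_of_all _ fun r hr => ?_
          have hr0 : 0 < r := hξ.1.trans hr.1
          have hr3 : r ^ 3 ≤ ρ ^ 3 := by gcongr; exact hr.2
          have hr5 : r ^ 5 ≤ ρ ^ 5 := by gcongr; exact hr.2
          have hvr := hv r ⟨hr0, hr.2⟩
          rw [Real.norm_eq_abs, abs_mul, abs_of_pos (pow_pos hr0 3)]
          have y1 : r ^ 3 * |g r| ≤ ρ ^ 3 / (2 * ε) * (g r ^ 2 * r) + ε * ρ ^ 2 / 2 := by
            have y2 : ε * r ^ 5 / (2 * ρ ^ 3) ≤ ε * ρ ^ 2 / 2 := by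
              rw [div_le_div_iff₀ (by positivity) (by positivity)]
              nlinarith [mul_le_mul_of_nonneg_left hr5 hε.le]
            have y3 : r ^ 3 * |g r| ≤ ρ ^ 3 / (2 * ε) * (g r ^ 2 * r)
                + ε * r ^ 5 / (2 * ρ ^ 3) := by
              have : 0 ≤ r * (ρ ^ 3 * |g r| - ε * r ^ 2) ^ 2 / (2 * ε * ρ ^ 3) := by positivity
              have e : ρ ^ 3 / (2 * ε) * (g r ^ 2 * r) + ε * r ^ 5 / (2 * ρ ^ 3) - r ^ 3 * |g r|
                  = r * (ρ ^ 3 * |g r| - ε * r ^ 2) ^ 2 / (2 * ε * ρ ^ 3) := by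
                rw [← sq_abs (g r)]
                field_simp
                ring
              linarith
            linarith
          have y4 : r ^ 3 * (μ * |v r|) ≤ ρ ^ 3 * μ := by
            have : μ * |v r| ≤ μ := by nlinarith
            exact mul_le_mul hr3 this (by positivity) (by positivity)
          calc r ^ 3 * |μ * v r - g r| ≤ r ^ 3 * (|μ * v r| + |g r|) := by
                gcongr; exact abs_sub _ _
            _ = r ^ 3 * (μ * |v r|) + r ^ 3 * |g r| := by
                rw [abs_mul, abs_of_nonneg hμ]; ring
            _ ≤ B r := by simp only [B]; linarith) iB
      have hBint : ∫ r in ξ..ρ, B r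
          = ρ ^ 3 / (2 * ε) * (∫ r in ξ..ρ, g r ^ 2 * r)
            + (ρ - ξ) * (ρ ^ 3 * μ + ε * ρ ^ 2 / 2) := by
        simp only [B]
        rw [intervalIntegral.integral_add (iG.const_mul _) intervalIntegrable_const,
          intervalIntegral.integral_const_mul, intervalIntegral.integral_const, smul_eq_mul]
      have hmono : ∫ r in ξ..ρ, g r ^ 2 * r ≤ Γ ρ := by
        refine intervalIntegral.integral_mono_interval hξ.1.le hξ.2.le le_rfl ?_ ?_
        · filter_upwards [ae_restrict_mem measurableSet_Ioc] with r hr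
          exact mul_nonneg (sq_nonneg _) hr.1.le
        · rw [intervalIntegrable_iff_integrableOn_Ioc_of_le hρ0.le]
          exact hg.mono_set fun r hr => ⟨hr.1, hr.2.trans_lt hρ.2⟩
      rw [hint, Real.norm_eq_abs, hBint] at hb
      have t1 : |ρ ^ 3 * v₁ ρ| ≤ |ρ ^ 3 * v₁ ρ - ξ ^ 3 * v₁ ξ| + |ξ ^ 3 * v₁ ξ| := by
        have := abs_add_le (ρ ^ 3 * v₁ ρ - ξ ^ 3 * v₁ ξ) (ξ ^ 3 * v₁ ξ)
        rwa [sub_add_cancel] at this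
      have t2 : ρ ^ 3 / (2 * ε) * (∫ r in ξ..ρ, g r ^ 2 * r) ≤ ρ ^ 3 / (2 * ε) * Γ ρ := by gcongr
      have t3 : (ρ - ξ) * (ρ ^ 3 * μ + ε * ρ ^ 2 / 2) ≤ ρ * (ρ ^ 3 * μ + ε * ρ ^ 2 / 2) := by
        have := hξ.1
        gcongr
        linarith
      have t4 : ρ ^ 3 * (ρ * μ + (Γ ρ / (2 * ε) + ε / 2))
          = ρ ^ 3 / (2 * ε) * Γ ρ + ρ * (ρ ^ 3 * μ + ε * ρ ^ 2 / 2) := by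
        field_simp
        ring
      linarith
    rw [abs_mul, abs_of_pos (pow_pos hρ0 3)] at step
    exact le_of_mul_le_mul_left step (pow_pos hρ0 3)
  rw [Metric.tendsto_nhds]
  intro ε hε
  obtain ⟨b, hb, hb'⟩ := mem_nhdsGT_iff_exists_Ioo_subset.1
    (h0 (Metric.ball_mem_nhds 0 one_pos))
  have hlim : Tendsto (fun ρ => ρ * μ + (Γ ρ / (2 * ε) + ε / 2)) (𝓝[>] 0) (𝓝 (ε / 2)) := by
    have hid : Tendsto (fun ρ : ℝ => ρ) (𝓝[>] 0) (𝓝 0) := nhdsWithin_le_nhds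
    have := (hid.mul_const μ).add ((hΓ0.div_const (2 * ε)).add_const (ε / 2))
    simpa using this
  filter_upwards [hlim.eventually_lt_const (half_lt_self hε), Ioo_mem_nhdsGT hb,
    Ioo_mem_nhdsGT hR] with ρ a1 a2 a3
  rw [Real.dist_eq, sub_zero]
  refine (main ε hε ρ a3 fun r hr => ?_).trans_lt a1
  have := hb' (⟨hr.1, hr.2.trans_lt a2.2⟩ : r ∈ Ioo 0 b)
  simp only [mem_preimage, Metric.mem_ball, Real.dist_eq, sub_zero] at this
  exact this.le

theorem tendsto_div_zero (hR : 0 < R) (h1 : ∀ r ∈ Ioo 0 R, HasDerivAt v (v₁ r) r)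
    (h0 : Tendsto v (𝓝[>] 0) (𝓝 0)) (hv1 : Tendsto v₁ (𝓝[>] 0) (𝓝 0)) :
    Tendsto (fun r => v r / r) (𝓝[>] 0) (𝓝 0) := by
  have hid : Tendsto (fun ρ : ℝ => ρ) (𝓝[>] 0) (𝓝 0) := nhdsWithin_le_nhds
  refine HasDerivAt.lhopital_zero_right_on_Ioo (f' := v₁) (g' := fun _ => 1) hR h1
    (fun r _ => hasDerivAt_id r) (by simp) h0 hid (by simpa using hv1)

/-- The energy estimate for the radial equation `-v'' - (3/r) v' + μ v = g` on `(0, R)` with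
`v(0) = v(R) = 0`. Both sides may be infinite. -/
theorem lintegral_density_le (hR : 0 < R) (hμ : 0 ≤ μ)
    (h1 : ∀ r ∈ Ioo 0 R, HasDerivAt v (v₁ r) r)
    (h2 : ∀ r ∈ Ioo 0 R, HasDerivAt v₁ (v₂ r) r) (hc : ContinuousOn v₂ (Ioo 0 R))
    (h0 : Tendsto v (𝓝[>] 0) (𝓝 0)) (hvR : Tendsto v (𝓝[<] R) (𝓝 0)) :
    ∫⁻ r in Ioo 0 R, ENNReal.ofReal (density μ r (v r) (v₁ r) (v₂ r))
      ≤ 400 * ∫⁻ r in Ioo 0 R,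
          ENNReal.ofReal ((-v₂ r - 3 / r * v₁ r + μ * v r) ^ 2 * r) := by
  set g : ℝ → ℝ := fun r => -v₂ r - 3 / r * v₁ r + μ * v r with hgdef
  have cg : ContinuousOn (fun r => g r ^ 2 * r) (Ioo 0 R) :=
    ((continuousOn_rhs h1 h2 hc).pow 2).mul continuousOn_id
  have cQ := continuousOn_density (μ := μ) h1 h2 hc
  rcases eq_or_ne (∫⁻ r in Ioo 0 R, ENNReal.ofReal (g r ^ 2 * r)) ⊤ with htop | hfin
  · rw [htop, ENNReal.mul_top (by norm_num)]; exact le_top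
  have hgi : IntegrableOn (fun r => g r ^ 2 * r) (Ioo 0 R) := by
    refine ⟨cg.aestronglyMeasurable measurableSet_Ioo, ?_⟩
    rw [hasFiniteIntegral_iff_ofReal]
    · exact hfin.lt_top
    · filter_upwards [ae_restrict_mem measurableSet_Ioo] with r hr
      exact mul_nonneg (sq_nonneg _) hr.1.le
  have hv1 := tendsto_deriv_zero hR h1 h2 hc h0 hμ hgi
  have hw := tendsto_div_zero hR h1 h0 hv1
  have hid : Tendsto (fun ρ : ℝ => ρ) (𝓝[>] 0) (𝓝 0) := nhdsWithin_le_nhds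
  -- The energy vanishes on the axis.
  have hE0 : Tendsto (fun s => energy μ s (v s) (v₁ s)) (𝓝[>] 0) (𝓝 0) := by
    have hp := hv1.sub hw
    have := (((((hp.pow 2).div_const 2).add ((hw.pow 2).const_mul (3 / 2))).sub
      (((h0.pow 2).const_mul μ).div_const 2)).const_mul 5 |>.add (hw.mul hp) |>.sub
      (((hid.mul h0).mul hp).const_mul μ)).const_mul 40
    simpa [energy] using this
  -- Completing the square in `p`, the energy is bounded below by a term vanishing at `r = R`.
  set K : ℝ → ℝ := fun r => 40 * (5 / 2 * μ * v r ^ 2 + (v r / r - μ * r * v r) ^ 2) with hK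
  have hEK : ∀ r, -energy μ r (v r) (v₁ r) ≤ K r := by
    intro r
    simp only [hK, energy]
    nlinarith [sq_nonneg (5 * (v₁ r - v r / r) + 2 * (v r / r - μ * r * v r)),
      sq_nonneg (v r / r), sq_nonneg (v₁ r - v r / r), sq_nonneg (v r / r - μ * r * v r)]
  have hKR : Tendsto K (𝓝[<] R) (𝓝 0) := by
    have hidR : Tendsto (fun ρ : ℝ => ρ) (𝓝[<] R) (𝓝 R) := nhdsWithin_le_nhds
    have := (((hvR.pow 2).const_mul (5 / 2 * μ)).add
      (((hvR.div hidR hR.ne').sub ((hidR.const_mul μ).mul hvR)).pow 2)).const_mul 40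
    simpa [hK] using this
  have hst : ∀ s t, 0 < s → s ≤ t → t < R →
      ∫⁻ r in Ioc s t, ENNReal.ofReal (density μ r (v r) (v₁ r) (v₂ r))
        ≤ ENNReal.ofReal (energy μ s (v s) (v₁ s) + K t)
          + 400 * ∫⁻ r in Ioo 0 R, ENNReal.ofReal (g r ^ 2 * r) := by
    intro s t hs hst ht
    have hsub : Icc s t ⊆ Ioo 0 R := fun r hr => ⟨hs.trans_le hr.1, hr.2.trans_lt ht⟩
    have hsub' : Ioc s t ⊆ Ioo 0 R := Ioc_subset_Icc_self.trans hsub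
    have hQi : IntegrableOn (fun r => density μ r (v r) (v₁ r) (v₂ r)) (Icc s t) :=
      (cQ.mono hsub).integrableOn_Icc
    have hGi : IntegrableOn (fun r => g r ^ 2 * r) (Icc s t) := (cg.mono hsub).integrableOn_Icc
    have hle : ∫ r in s..t, density μ r (v r) (v₁ r) (v₂ r) - 400 * (g r ^ 2 * r)
        ≤ -energy μ t (v t) (v₁ t) - -energy μ s (v s) (v₁ s) := by
      choose! D hD hD' using fun r (hr : r ∈ Ioo 0 R) => energy_ineq hμ hr.1 (h1 r hr) (h2 r hr)
      refine intervalIntegral.integral_le_sub_of_hasDeriv_right_of_le hst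
        (g := fun r => -energy μ r (v r) (v₁ r)) (g' := fun r => -D r)
        (φ := fun r => density μ r (v r) (v₁ r) (v₂ r) - 400 * (g r ^ 2 * r)) ?_ ?_ ?_ ?_
      · exact fun r hr => (hD r (hsub hr)).neg.continuousAt.continuousWithinAt
      · exact fun r hr => (hD r (hsub (Ioo_subset_Icc_self hr))).neg.hasDerivWithinAt
      · exact hQi.sub (hGi.const_mul 400)
      · intro r hr
        have := hD' r (hsub (Ioo_subset_Icc_self hr))
        simp only [hgdef]
        linarith
    have iQ : IntervalIntegrable (fun r => density μ r (v r) (v₁ r) (v₂ r)) volume s t :=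
      (hQi.mono_set (by rw [uIcc_of_le hst])).intervalIntegrable
    have iG : IntervalIntegrable (fun r => g r ^ 2 * r) volume s t :=
      (hGi.mono_set (by rw [uIcc_of_le hst])).intervalIntegrable
    rw [intervalIntegral.integral_sub iQ (iG.const_mul 400),
      intervalIntegral.integral_const_mul, intervalIntegral.integral_of_le hst,
      intervalIntegral.integral_of_le hst] at hle
    have nQ : 0 ≤ᵐ[volume.restrict (Ioc s t)] fun r => density μ r (v r) (v₁ r) (v₂ r) := by
      filter_upwards [ae_restrict_mem measurableSet_Ioc] with r hr
      exact density_nonneg hμ (hsub' hr).1.le _ _ _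
    have nG : 0 ≤ᵐ[volume.restrict (Ioc s t)] fun r => g r ^ 2 * r := by
      filter_upwards [ae_restrict_mem measurableSet_Ioc] with r hr
      exact mul_nonneg (sq_nonneg _) (hsub' hr).1.le
    rw [← ofReal_integral_eq_lintegral_ofReal (hQi.mono_set Ioc_subset_Icc_self) nQ]
    calc ENNReal.ofReal (∫ r in Ioc s t, density μ r (v r) (v₁ r) (v₂ r))
        ≤ ENNReal.ofReal ((energy μ s (v s) (v₁ s) + K t)
            + 400 * ∫ r in Ioc s t, g r ^ 2 * r) :=
          ENNReal.ofReal_le_ofReal (by linarith [hEK t])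
      _ ≤ ENNReal.ofReal (energy μ s (v s) (v₁ s) + K t)
            + ENNReal.ofReal (400 * ∫ r in Ioc s t, g r ^ 2 * r) := ENNReal.ofReal_add_le
      _ ≤ _ := by
          rw [ENNReal.ofReal_mul (by norm_num),
            ofReal_integral_eq_lintegral_ofReal (hGi.mono_set Ioc_subset_Icc_self) nG]
          norm_num
          gcongr
  -- Exhaustion of `(0, R)` by compact intervals.
  set d : ℕ → ℝ := fun n => R / (n + 2) with hd
  have hd0 : ∀ n, 0 < d n := fun n => by positivity
  have hd2 : ∀ n, d n ≤ R / 2 := fun n => by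
    simp only [hd]
    gcongr
    linarith [(Nat.cast_nonneg n : (0 : ℝ) ≤ n)]
  have hdl : Tendsto d atTop (𝓝 0) := by
    have := (tendsto_natCast_atTop_atTop (R := ℝ)).atTop_add (tendsto_const_nhds (x := (2 : ℝ)))
    exact this.const_div_atTop R
  have hdl' : Tendsto (fun n => R - d n) atTop (𝓝 R) := by
    simpa using hdl.const_sub R
  have hcov : AECover (volume.restrict (Ioo 0 R)) atTop fun n => Ioc (d n) (R - d n) :=
    aecover_Ioo_of_Ioc hdl hdl'
  have hlim := hcov.lintegral_tendsto_of_countably_generated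
    (f := fun r => ENNReal.ofReal (density μ r (v r) (v₁ r) (v₂ r)))
    (cQ.aemeasurable measurableSet_Ioo).ennreal_ofReal
  have l1 : Tendsto d atTop (𝓝[>] 0) :=
    tendsto_nhdsWithin_iff.2 ⟨hdl, Eventually.of_forall hd0⟩
  have l2 : Tendsto (fun n => R - d n) atTop (𝓝[<] R) :=
    tendsto_nhdsWithin_iff.2 ⟨hdl', Eventually.of_forall fun n => by
      simp only [mem_Iio]; linarith [hd0 n]⟩
  have hrhs : Tendsto (fun n => ENNReal.ofReal
      (energy μ (d n) (v (d n)) (v₁ (d n)) + K (R - d n))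
        + 400 * ∫⁻ r in Ioo 0 R, ENNReal.ofReal (g r ^ 2 * r)) atTop
      (𝓝 (400 * ∫⁻ r in Ioo 0 R, ENNReal.ofReal (g r ^ 2 * r))) := by
    have := (ENNReal.tendsto_ofReal ((hE0.comp l1).add (hKR.comp l2))).add_const
      (400 * ∫⁻ r in Ioo 0 R, ENNReal.ofReal (g r ^ 2 * r))
    simpa using this
  refine le_of_tendsto_of_tendsto' hlim hrhs fun n => ?_
  have hsub : Ioc (d n) (R - d n) ⊆ Ioo 0 R := fun r hr =>
    ⟨(hd0 n).trans hr.1, by linarith [hr.2, hd0 n]⟩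
  rw [Measure.restrict_restrict measurableSet_Ioc, inter_eq_left.2 hsub]
  exact hst _ _ (hd0 n) (by linarith [hd2 n]) (by linarith [hd0 n])

end Radial

/-! ### Fourier modes in the axial variable -/

/-- The coefficient of `F(r, ·)` on `(-a, a)` with respect to the (unnormalised) test function
`χ`. -/
noncomputable def mode (a : ℝ) (χ : ℝ → ℝ) (F : ℝ × ℝ → ℝ) (r : ℝ) : ℝ :=
  ∫ z in (-a)..a, F (r, z) * χ z

section Mode

variable {R a : ℝ} {χ χ' : ℝ → ℝ} {F G : ℝ × ℝ → ℝ}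

theorem continuous_slice {A : Set ℝ} (hF : ContinuousOn F (A ×ˢ univ)) {r : ℝ} (hr : r ∈ A) :
    Continuous fun z => F (r, z) :=
  hF.comp_continuous (by fun_prop) fun _ => ⟨hr, mem_univ _⟩

theorem continuousOn_mode {A : Set ℝ} (hχ : Continuous χ) (hF : ContinuousOn F (A ×ˢ univ)) :
    ContinuousOn (mode a χ F) A := by
  rw [continuousOn_iff_continuous_domRestrict]
  have h : Continuous (Function.uncurry fun (r : A) (z : ℝ) => F (r, z) * χ z) :=
    (hF.comp_continuous (f := fun q : A × ℝ => ((q.1 : ℝ), q.2)) (by fun_prop)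
      fun q => ⟨q.1.2, mem_univ _⟩).mul (hχ.comp continuous_snd)
  exact intervalIntegral.continuous_parametric_intervalIntegral_of_continuous' h (-a) a

/-- Modes may be differentiated in the radial variable under the integral sign. -/
theorem hasDerivAt_mode (ha : 0 < a) (hχ : Continuous χ)
    (hF : ContDiffOn ℝ 1 F (Ioo 0 R ×ˢ univ)) {r : ℝ} (hr : r ∈ Ioo 0 R) :
    HasDerivAt (mode a χ F) (mode a χ (dr F) r) r := by
  have hS := isOpen_strip R
  have hF' : ContDiffOn ℝ ((0 : ℕ) + 1) F (Ioo 0 R ×ˢ univ) := by simpa using hF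
  have cF := hF.continuousOn
  have cD : ContinuousOn (dr F) (Ioo 0 R ×ˢ univ) := (contDiffOn_dr hS hF').continuousOn
  obtain ⟨l, hl, u, hu, hlu⟩ : ∃ l, l < r ∧ ∃ u, r < u ∧ Icc l u ⊆ Ioo 0 R :=
    ⟨r / 2, by linarith [hr.1], (r + R) / 2, by linarith [hr.2], fun x hx =>
      ⟨by linarith [hx.1, hr.1], by linarith [hx.2, hr.2]⟩⟩
  have cB : ContinuousOn (fun q : ℝ × ℝ => dr F q * χ q.2) (Icc l u ×ˢ Icc (-a) a) :=
    (cD.mono (prod_mono hlu (subset_univ _))).mul (hχ.comp continuous_snd).continuousOn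
  obtain ⟨C, hC⟩ := (isCompact_Icc.prod isCompact_Icc).exists_bound_of_continuousOn cB
  have hnhds : Ioo l u ∈ 𝓝 r := Ioo_mem_nhds hl hu
  have hio : Ioc (-a) a ⊆ Icc (-a) a := Ioc_subset_Icc_self
  refine (intervalIntegral.hasDerivAt_integral_of_dominated_loc_of_deriv_le
    (F := fun r z => F (r, z) * χ z) (F' := fun r z => dr F (r, z) * χ z) (bound := fun _ => C)
    hnhds ?_ ?_ ?_ ?_ intervalIntegrable_const ?_).2
  · filter_upwards [hnhds] with s hs
    exact ((continuous_slice cF (hlu (Ioo_subset_Icc_self hs))).mul hχ).aestronglyMeasurable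
  · exact ((continuous_slice cF hr).mul hχ).intervalIntegrable _ _
  · exact ((continuous_slice cD hr).mul hχ).aestronglyMeasurable
  · refine ae_of_all _ fun z hz s hs => hC (s, z) ⟨Ioo_subset_Icc_self hs, hio ?_⟩
    rwa [uIoc_of_le (by linarith)] at hz
  · refine ae_of_all _ fun z _ s hs => ?_
    exact (hasDerivAt_dr (differentiableAt_of_contDiffOn hS hF'
      ⟨hlu (Ioo_subset_Icc_self hs), mem_univ _⟩)).mul_const _

theorem mode_dz (hχ : ∀ z, HasDerivAt χ (χ' z) z) (hχ' : Continuous χ') (hper : χ a = χ (-a))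
    (hF : ContDiffOn ℝ 1 F (Ioo 0 R ×ˢ univ)) {r : ℝ} (hr : r ∈ Ioo 0 R)
    (hFper : ∀ z, F (r, z + 2 * a) = F (r, z)) :
    mode a χ (dz F) r = -mode a χ' F r := by
  have hS := isOpen_strip R
  have hF' : ContDiffOn ℝ ((0 : ℕ) + 1) F (Ioo 0 R ×ˢ univ) := by simpa using hF
  have cF := continuous_slice hF.continuousOn hr
  have cD : Continuous fun z => dz F (r, z) :=
    continuous_slice (contDiffOn_dz hS hF').continuousOn hr
  have cχ : Continuous χ := continuous_iff_continuousAt.2 fun z => (hχ z).continuousAt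
  have e : F (r, a) = F (r, -a) := by rw [← hFper (-a)]; congr 2; ring
  have h := intervalIntegral.integral_mul_deriv_eq_deriv_mul (a := -a) (b := a)
    (u := χ) (v := fun z => F (r, z)) (u' := χ') (v' := fun z => dz F (r, z))
    (fun z _ => hχ z) (fun z _ => hasDerivAt_dz
      (differentiableAt_of_contDiffOn hS hF' ⟨hr, mem_univ _⟩))
    (hχ'.intervalIntegrable _ _) (cD.intervalIntegrable _ _)
  rw [hper, e, sub_self, zero_sub] at h
  simp only [mode, mul_comm (dz F _), mul_comm (F _)]
  exact h

end Mode

/-- **Parseval's identity** for a real continuous function on `[-a, a]`, in terms of cosine and sine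
coefficients. The sum runs over all integers, so that each frequency is met twice. -/
theorem hasSum_sq_cos_sin {a : ℝ} (ha : 0 < a) {f : ℝ → ℝ} (hf : Continuous f) :
    HasSum (fun n : ℤ => (2 * a)⁻¹ * ((∫ z in (-a)..a, f z * Real.cos (Real.pi * n / a * z)) ^ 2
      + (∫ z in (-a)..a, f z * Real.sin (Real.pi * n / a * z)) ^ 2))
      (∫ z in (-a)..a, f z ^ 2) := by
  have hab : -a < a := by linarith
  have hcf : Continuous fun z => (f z : ℂ) := Complex.continuous_ofReal.comp hf
  have hL2 : MemLp (fun z => (f z : ℂ)) 2 (volume.restrict (Ioc (-a) a)) :=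
    (memLp_two_iff_integrable_sq_norm hcf.aestronglyMeasurable).2
      ((hcf.norm.pow 2).integrableOn_Icc.mono_set Ioc_subset_Icc_self)
  have h := (hasSum_sq_fourierCoeffOn hab hL2).mul_left (2 * a)
  have e2 : a - -a = 2 * a := by ring
  have coeff : ∀ n : ℤ, fourierCoeffOn hab (fun z => (f z : ℂ)) n
      = ((2 * a)⁻¹ : ℝ) * (((∫ z in (-a)..a, f z * Real.cos (Real.pi * n / a * z) : ℝ) : ℂ)
        - ((∫ z in (-a)..a, f z * Real.sin (Real.pi * n / a * z) : ℝ) : ℂ) * Complex.I) := by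
    intro n
    rw [fourierCoeffOn_eq_integral, e2, Complex.real_smul, one_div,
      ← intervalIntegral.integral_ofReal, ← intervalIntegral.integral_ofReal,
      ← intervalIntegral.integral_mul_const, ← intervalIntegral.integral_sub]
    · congr 1
      refine intervalIntegral.integral_congr fun z _ => ?_
      have e3 : (2 * Real.pi * Complex.I * ((-n : ℤ) : ℂ) * z / ((2 * a : ℝ) : ℂ))
          = ((-(Real.pi * n / a * z) : ℝ) : ℂ) * Complex.I := by
        have : (a : ℂ) ≠ 0 := by exact_mod_cast ha.ne'
        push_cast
        field_simp
      have e4 : (fourier (-n) (z : AddCircle (2 * a)) : ℂ)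
          = Complex.exp (((-(Real.pi * n / a * z) : ℝ) : ℂ) * Complex.I) := by
        rw [fourier_coe_apply, ← e3]
      simp only [smul_eq_mul]
      rw [e4, Complex.exp_mul_I, ← Complex.ofReal_cos, ← Complex.ofReal_sin, Real.cos_neg,
        Real.sin_neg]
      push_cast
      ring
    · exact (Complex.continuous_ofReal.comp (by fun_prop)).intervalIntegrable _ _
    · exact ((Complex.continuous_ofReal.comp (by fun_prop)).mul
        continuous_const).intervalIntegrable _ _
  have hval : ∫ z in (-a)..a, f z ^ 2
      = 2 * a * ((a - -a)⁻¹ • ∫ z in (-a)..a, ‖(f z : ℂ)‖ ^ 2) := by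
    rw [e2, smul_eq_mul, mul_inv_cancel_left₀ (by positivity)]
    simp
  rw [hval]
  refine h.congr_fun fun n => ?_
  rw [coeff, ← Complex.normSq_eq_norm_sq, Complex.normSq_mul, Complex.normSq_ofReal]
  simp only [Complex.normSq_apply, Complex.sub_re, Complex.sub_im, Complex.ofReal_re,
    Complex.ofReal_im, Complex.mul_re, Complex.mul_im, Complex.I_re, Complex.I_im]
  field_simp
  ring

/-- Tonelli's theorem on `Ω` combined with an expansion of the inner integral into a series. -/
theorem lintegral_Omega_eq_tsum {R a : ℝ} (ha : 0 < a) {T : ℝ × ℝ → ℝ} {q : ℤ → ℝ → ℝ}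
    (hT : ContinuousOn T (Ioo 0 R ×ˢ univ)) (hT0 : ∀ p ∈ Ioo 0 R ×ˢ (univ : Set ℝ), 0 ≤ T p)
    (hq : ∀ n, ContinuousOn (q n) (Ioo 0 R)) (hq0 : ∀ n, ∀ r ∈ Ioo 0 R, 0 ≤ q n r)
    (hsum : ∀ r ∈ Ioo 0 R, HasSum (fun n => q n r) (∫ z in (-a)..a, T (r, z))) :
    ∫⁻ p in Omega R a, ENNReal.ofReal (T p)
      = ∑' n, ∫⁻ r in Ioo 0 R, ENNReal.ofReal (q n r) := by
  have hle : -a ≤ a := by linarith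
  have hmeas : AEMeasurable (fun p => ENNReal.ofReal (T p)) (volume.restrict (Omega R a)) :=
    ((hT.mono (prod_mono le_rfl (subset_univ _))).aemeasurable
      (measurableSet_Ioo.prod measurableSet_Ioo)).ennreal_ofReal
  rw [← lintegral_tsum fun n => ((hq n).aemeasurable measurableSet_Ioo).ennreal_ofReal]
  unfold Omega at hmeas ⊢
  rw [Measure.volume_eq_prod, ← Measure.prod_restrict] at hmeas ⊢
  rw [lintegral_prod _ hmeas]
  refine setLIntegral_congr_fun measurableSet_Ioo fun r hr => ?_
  have hint : IntegrableOn (fun z => T (r, z)) (Ioc (-a) a) :=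
    ((continuous_slice hT hr).intervalIntegrable (-a) a).1
  change ∫⁻ z in Ioo (-a) a, ENNReal.ofReal (T (r, z)) = ∑' n, ENNReal.ofReal (q n r)
  rw [← ENNReal.ofReal_tsum_of_nonneg (fun n => hq0 n r hr) (hsum r hr).summable,
    (hsum r hr).tsum_eq, intervalIntegral.integral_of_le hle,
    ofReal_integral_eq_lintegral_ofReal hint (ae_of_all _ fun z => hT0 _ ⟨hr, mem_univ _⟩)]
  exact (setLIntegral_congr Ioo_ae_eq_Ioc)

/-! ### The estimate for the axial derivative -/

section Estimate

variable {R a μ : ℝ} {χ χ' : ℝ → ℝ} {u : ℝ × ℝ → ℝ}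

/-- Minus the operator `∂_r² + ∂_z² + (3/r) ∂_r`. -/
noncomputable def source (u : ℝ × ℝ → ℝ) (p : ℝ × ℝ) : ℝ :=
  -dr (dr u) p - dz (dz u) p - 3 / p.1 * dr u p

theorem continuousOn_div_fst_pow (n : ℕ) (hu : ContinuousOn u (Ioo 0 R ×ˢ univ)) :
    ContinuousOn (fun p => u p / p.1 ^ n) (Ioo 0 R ×ˢ univ) :=
  hu.div (continuousOn_fst.pow n) fun _ hp => (pow_pos hp.1.1 n).ne'

theorem contDiffOn_derivs (hu : ContDiffOn ℝ 2 u (Ioo 0 R ×ˢ univ)) :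
    ContDiffOn ℝ 1 (dr u) (Ioo 0 R ×ˢ univ) ∧ ContDiffOn ℝ 1 (dz u) (Ioo 0 R ×ˢ univ) ∧
      ContinuousOn (dr (dr u)) (Ioo 0 R ×ˢ univ) ∧ ContinuousOn (dz (dz u)) (Ioo 0 R ×ˢ univ) := by
  have hS := isOpen_strip R
  have hu' : ContDiffOn ℝ ((1 : ℕ) + 1) u (Ioo 0 R ×ˢ univ) := by norm_num; exact hu
  have h1 : ContDiffOn ℝ ((0 : ℕ) + 1) (dr u) (Ioo 0 R ×ˢ univ) := by
    simpa using contDiffOn_dr hS hu'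
  have h2 : ContDiffOn ℝ ((0 : ℕ) + 1) (dz u) (Ioo 0 R ×ˢ univ) := by
    simpa using contDiffOn_dz hS hu'
  exact ⟨by simpa using h1, by simpa using h2, (contDiffOn_dr hS h1).continuousOn,
    (contDiffOn_dz hS h2).continuousOn⟩

theorem continuousOn_source (hu : ContDiffOn ℝ 2 u (Ioo 0 R ×ˢ univ)) :
    ContinuousOn (source u) (Ioo 0 R ×ˢ univ) := by
  obtain ⟨h1, -, h3, h4⟩ := contDiffOn_derivs hu
  exact (h3.neg.sub h4).sub ((continuousOn_const.div continuousOn_fst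
    fun _ hp => hp.1.1.ne').mul h1.continuousOn)

/-- The modes of a solution solve the radial equation. -/
theorem mode_source (hχ : ∀ z, HasDerivAt χ (χ' z) z) (hχ' : ∀ z, HasDerivAt χ' (-μ * χ z) z)
    (e : χ a = χ (-a)) (e' : χ' a = χ' (-a)) (hu : ContDiffOn ℝ 2 u (Ioo 0 R ×ˢ univ))
    {r : ℝ} (hr : r ∈ Ioo 0 R) (hper : ∀ z, u (r, z + 2 * a) = u (r, z)) :
    mode a χ (source u) r
      = -mode a χ (dr (dr u)) r - 3 / r * mode a χ (dr u) r + μ * mode a χ u r := by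
  obtain ⟨h1, h2, h3, h4⟩ := contDiffOn_derivs hu
  have cχ : Continuous χ := continuous_iff_continuousAt.2 fun z => (hχ z).continuousAt
  have cχ' : Continuous χ' := continuous_iff_continuousAt.2 fun z => (hχ' z).continuousAt
  have hzz : mode a χ (dz (dz u)) r = -μ * mode a χ u r := by
    rw [mode_dz hχ cχ' e h2 hr (dz_periodic hper),
      mode_dz hχ' (by fun_prop) e' (hu.of_le (by norm_num)) hr hper, neg_neg]
    simp only [mode]
    rw [← intervalIntegral.integral_const_mul]
    congr 1; ext z; ring
  have i1 : IntervalIntegrable (fun z => dr (dr u) (r, z) * χ z) volume (-a) a :=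
    ((continuous_slice h3 hr).mul cχ).intervalIntegrable _ _
  have i2 : IntervalIntegrable (fun z => dz (dz u) (r, z) * χ z) volume (-a) a :=
    ((continuous_slice h4 hr).mul cχ).intervalIntegrable _ _
  have i3 : IntervalIntegrable (fun z => dr u (r, z) * χ z) volume (-a) a :=
    ((continuous_slice h1.continuousOn hr).mul cχ).intervalIntegrable _ _
  have : mode a χ (source u) r
      = -mode a χ (dr (dr u)) r - mode a χ (dz (dz u)) r - 3 / r * mode a χ (dr u) r := by
    have i4 : IntervalIntegrable (fun z => -(dr (dr u) (r, z) * χ z)) volume (-a) a := i1.neg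
    have i5 : IntervalIntegrable (fun z => -(dr (dr u) (r, z) * χ z) - dz (dz u) (r, z) * χ z)
        volume (-a) a := i4.sub i2
    simp only [mode, source]
    rw [← intervalIntegral.integral_const_mul, ← intervalIntegral.integral_neg,
      ← intervalIntegral.integral_sub i4 i2,
      ← intervalIntegral.integral_sub i5 (i3.const_mul _)]
    congr 1; ext z; ring
  rw [this, hzz]
  ring

/-- The radial estimate applied to one mode of the axial derivative `u = ψ_z`. Although `ψ_z` is
not known to be continuous up to the boundary, its modes are, being modes of `ψ`. -/
theorem lintegral_mode_le (hR : 0 < R) (ha : 0 < a) {ψ ω : ℝ × ℝ → ℝ}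
    (h : IsRegularSolution R a ψ ω) (h0 : ∀ z, ψ (0, z) = 0) (hμ : 0 ≤ μ)
    (hχ : ∀ z, HasDerivAt χ (χ' z) z) (hχ' : ∀ z, HasDerivAt χ' (-μ * χ z) z)
    (e : χ a = χ (-a)) (e' : χ' a = χ' (-a)) (hu : ContDiffOn ℝ 2 (dz ψ) (Ioo 0 R ×ˢ univ)) :
    ∫⁻ r in Ioo 0 R, ENNReal.ofReal (density μ r (mode a χ (dz ψ) r) (mode a χ (dr (dz ψ)) r)
        (mode a χ (dr (dr (dz ψ))) r))
      ≤ 400 * ∫⁻ r in Ioo 0 R, ENNReal.ofReal (mode a χ (source (dz ψ)) r ^ 2 * r) := by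
  obtain ⟨h1, h2, h3, h4⟩ := contDiffOn_derivs hu
  have cχ : Continuous χ := continuous_iff_continuousAt.2 fun z => (hχ z).continuousAt
  have cχ' : Continuous χ' := continuous_iff_continuousAt.2 fun z => (hχ' z).continuousAt
  have hψ : ∀ r ∈ Ioo 0 R, ∀ z, ψ (r, z + 2 * a) = ψ (r, z) :=
    fun r hr => h.periodic r (Ioo_subset_Icc_self hr)
  have hv : ∀ r ∈ Ioo 0 R, mode a χ (dz ψ) r = -mode a χ' ψ r := fun r hr =>
    mode_dz hχ cχ' e (h.contDiffOn.of_le (by norm_num)) hr (hψ r hr)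
  have hcont : ContinuousOn (mode a χ' ψ) (Icc 0 R) := continuousOn_mode cχ' h.continuousOn
  have m0 : mode a χ' ψ 0 = 0 := by simp [mode, h0]
  have mR : mode a χ' ψ R = 0 := by simp [mode, h.lateral]
  have t0 : Tendsto (mode a χ (dz ψ)) (𝓝[>] 0) (𝓝 0) := by
    have := (hcont 0 (left_mem_Icc.2 hR.le)).mono Ioo_subset_Icc_self
    rw [ContinuousWithinAt, nhdsWithin_Ioo_eq_nhdsGT hR, m0] at this
    have h5 := this.neg
    rw [neg_zero] at h5
    refine h5.congr' ?_
    filter_upwards [Ioo_mem_nhdsGT hR] with r hr using (hv r hr).symm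
  have tR : Tendsto (mode a χ (dz ψ)) (𝓝[<] R) (𝓝 0) := by
    have := (hcont R (right_mem_Icc.2 hR.le)).mono Ioo_subset_Icc_self
    rw [ContinuousWithinAt, nhdsWithin_Ioo_eq_nhdsLT hR, mR] at this
    have h5 := this.neg
    rw [neg_zero] at h5
    refine h5.congr' ?_
    filter_upwards [Ioo_mem_nhdsLT hR] with r hr using (hv r hr).symm
  refine (lintegral_density_le hR hμ (fun r hr => hasDerivAt_mode ha cχ (hu.of_le (by norm_num)) hr)
    (fun r hr => hasDerivAt_mode ha cχ h1 hr) (continuousOn_mode cχ h3) t0 tR).trans (le_of_eq ?_)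
  congr 1
  refine setLIntegral_congr_fun measurableSet_Ioo fun r hr => ?_
  simp only [mode_source hχ hχ' e e' hu hr (dz_periodic (hψ r hr))]

/-- The contribution of the frequency `π n / a` (cosine and sine modes together) to the left-hand
side of the estimate. -/
noncomputable def freqDensity (a : ℝ) (u : ℝ × ℝ → ℝ) (n : ℤ) (r : ℝ) : ℝ :=
  (2 * a)⁻¹ *
    (density ((Real.pi * n / a) ^ 2) r (mode a (fun z => Real.cos (Real.pi * n / a * z)) u r)
      (mode a (fun z => Real.cos (Real.pi * n / a * z)) (dr u) r)
      (mode a (fun z => Real.cos (Real.pi * n / a * z)) (dr (dr u)) r)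
    + density ((Real.pi * n / a) ^ 2) r (mode a (fun z => Real.sin (Real.pi * n / a * z)) u r)
      (mode a (fun z => Real.sin (Real.pi * n / a * z)) (dr u) r)
      (mode a (fun z => Real.sin (Real.pi * n / a * z)) (dr (dr u)) r))

/-- The contribution of the frequency `π n / a` to the weighted `L²` norm of `f`. -/
noncomputable def freqSq (a : ℝ) (f : ℝ × ℝ → ℝ) (n : ℤ) (r : ℝ) : ℝ :=
  (2 * a)⁻¹ * (mode a (fun z => Real.cos (Real.pi * n / a * z)) f r ^ 2 * r
    + mode a (fun z => Real.sin (Real.pi * n / a * z)) f r ^ 2 * r)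

theorem freqDensity_nonneg (ha : 0 < a) (n : ℤ) {r : ℝ} (hr : 0 ≤ r) :
    0 ≤ freqDensity a u n r :=
  mul_nonneg (by positivity) (add_nonneg (density_nonneg (sq_nonneg _) hr _ _ _)
    (density_nonneg (sq_nonneg _) hr _ _ _))

theorem freqSq_nonneg (ha : 0 < a) (n : ℤ) {r : ℝ} (hr : 0 ≤ r) : 0 ≤ freqSq a u n r := by
  unfold freqSq; positivity

theorem continuousOn_density_mode (ha : 0 < a) (hχ : Continuous χ)
    (hu : ContDiffOn ℝ 2 u (Ioo 0 R ×ˢ univ)) :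
    ContinuousOn (fun r => density μ r (mode a χ u r) (mode a χ (dr u) r)
      (mode a χ (dr (dr u)) r)) (Ioo 0 R) := by
  obtain ⟨h1, -, h3, -⟩ := contDiffOn_derivs hu
  exact continuousOn_density (fun r hr => hasDerivAt_mode ha hχ (hu.of_le (by norm_num)) hr)
    (fun r hr => hasDerivAt_mode ha hχ h1 hr) (continuousOn_mode hχ h3)

theorem continuousOn_mode_sq (hχ : Continuous χ) (hu : ContinuousOn u (Ioo 0 R ×ˢ univ)) :
    ContinuousOn (fun r => mode a χ u r ^ 2 * r) (Ioo 0 R) :=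
  ((continuousOn_mode hχ hu).pow 2).mul continuousOn_id

theorem continuousOn_freqDensity (ha : 0 < a) (hu : ContDiffOn ℝ 2 u (Ioo 0 R ×ˢ univ)) (n : ℤ) :
    ContinuousOn (freqDensity a u n) (Ioo 0 R) :=
  continuousOn_const.mul ((continuousOn_density_mode ha (by fun_prop) hu).add
    (continuousOn_density_mode ha (by fun_prop) hu))

theorem continuousOn_freqSq (hu : ContinuousOn u (Ioo 0 R ×ˢ univ)) (n : ℤ) :
    ContinuousOn (freqSq a u n) (Ioo 0 R) :=
  continuousOn_const.mul ((continuousOn_mode_sq (by fun_prop) hu).add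
    (continuousOn_mode_sq (by fun_prop) hu))

/-- Parseval's identity for the right-hand side of the estimate at a fixed radius. -/
theorem hasSum_freqSq (ha : 0 < a) (hu : ContinuousOn u (Ioo 0 R ×ˢ univ))
    {r : ℝ} (hr : r ∈ Ioo 0 R) :
    HasSum (fun n => freqSq a u n r) (∫ z in (-a)..a, u (r, z) ^ 2 * r) := by
  rw [intervalIntegral.integral_mul_const]
  refine ((hasSum_sq_cos_sin ha (continuous_slice hu hr)).mul_right r).congr_fun fun n => ?_
  simp only [freqSq, mode]
  ring

/-- Parseval's identity for the left-hand side of the estimate at a fixed radius. -/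
theorem hasSum_freqDensity (ha : 0 < a) (hu : ContDiffOn ℝ 2 u (Ioo 0 R ×ˢ univ))
    {r : ℝ} (hr : r ∈ Ioo 0 R) (hper : ∀ z, u (r, z + 2 * a) = u (r, z)) :
    HasSum (fun n => freqDensity a u n r)
      (∫ z in (-a)..a, (dz u (r, z) ^ 2 / r ^ 2 + (dr (dr u) (r, z) ^ 2 + dr u (r, z) ^ 2 / r ^ 2
        + u (r, z) ^ 2 / r ^ 4)) * r) := by
  obtain ⟨h1, h2, h3, h4⟩ := contDiffOn_derivs hu
  have c0 := continuous_slice hu.continuousOn hr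
  have c1 := continuous_slice h1.continuousOn hr
  have c2 := continuous_slice h2.continuousOn hr
  have c3 := continuous_slice h3 hr
  have s := (((hasSum_sq_cos_sin ha c2).div_const (r ^ 2)).add
    (((hasSum_sq_cos_sin ha c3).add ((hasSum_sq_cos_sin ha c1).div_const (r ^ 2))).add
      ((hasSum_sq_cos_sin ha c0).div_const (r ^ 4)))).mul_right r
  have hval : (∫ z in (-a)..a, (dz u (r, z) ^ 2 / r ^ 2 + (dr (dr u) (r, z) ^ 2
        + dr u (r, z) ^ 2 / r ^ 2 + u (r, z) ^ 2 / r ^ 4)) * r)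
      = ((∫ z in (-a)..a, dz u (r, z) ^ 2) / r ^ 2 + ((∫ z in (-a)..a, dr (dr u) (r, z) ^ 2)
        + (∫ z in (-a)..a, dr u (r, z) ^ 2) / r ^ 2 + (∫ z in (-a)..a, u (r, z) ^ 2) / r ^ 4)) * r := by
    have j0 : IntervalIntegrable (fun z => u (r, z) ^ 2 / r ^ 4) volume (-a) a :=
      ((c0.pow 2).div_const _).intervalIntegrable _ _
    have j1 : IntervalIntegrable (fun z => dr u (r, z) ^ 2 / r ^ 2) volume (-a) a :=
      ((c1.pow 2).div_const _).intervalIntegrable _ _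
    have j2 : IntervalIntegrable (fun z => dz u (r, z) ^ 2 / r ^ 2) volume (-a) a :=
      ((c2.pow 2).div_const _).intervalIntegrable _ _
    have j3 : IntervalIntegrable (fun z => dr (dr u) (r, z) ^ 2) volume (-a) a :=
      (c3.pow 2).intervalIntegrable _ _
    rw [intervalIntegral.integral_mul_const, intervalIntegral.integral_add j2 ((j3.add j1).add j0),
      intervalIntegral.integral_add (j3.add j1) j0, intervalIntegral.integral_add j3 j1]
    simp only [intervalIntegral.integral_div]
  rw [hval]
  refine s.congr_fun fun n => ?_
  have hcos : mode a (fun z => Real.cos (Real.pi * n / a * z)) (dz u) r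
      = Real.pi * n / a * mode a (fun z => Real.sin (Real.pi * n / a * z)) u r := by
    rw [mode_dz (χ' := fun z => -Real.sin (Real.pi * n / a * z) * (Real.pi * n / a))
      (fun z => ?_) (by fun_prop) (by simp) (hu.of_le (by norm_num)) hr hper]
    · simp only [mode]
      rw [← intervalIntegral.integral_const_mul, ← intervalIntegral.integral_neg]
      congr 1; ext z; ring
    · simpa using ((hasDerivAt_id z).const_mul (Real.pi * n / a)).cos
  have hsin : mode a (fun z => Real.sin (Real.pi * n / a * z)) (dz u) r
      = -(Real.pi * n / a * mode a (fun z => Real.cos (Real.pi * n / a * z)) u r) := by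
    rw [mode_dz (χ' := fun z => Real.cos (Real.pi * n / a * z) * (Real.pi * n / a))
      (fun z => ?_) (by fun_prop) ?_ (hu.of_le (by norm_num)) hr hper]
    · simp only [mode]
      rw [← intervalIntegral.integral_const_mul]
      congr 2; ext z; ring
    · have : Real.pi * n / a * a = n * Real.pi := by field_simp
      simp [this]
    · simpa using ((hasDerivAt_id z).const_mul (Real.pi * n / a)).sin
  simp only [freqDensity, density]
  simp only [mode] at hcos hsin ⊢
  rw [hcos, hsin]
  ring

theorem lintegral_freqDensity_le (hR : 0 < R) (ha : 0 < a) {ψ ω : ℝ × ℝ → ℝ}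
    (h : IsRegularSolution R a ψ ω) (h0 : ∀ z, ψ (0, z) = 0)
    (hu : ContDiffOn ℝ 2 (dz ψ) (Ioo 0 R ×ˢ univ)) (n : ℤ) :
    ∫⁻ r in Ioo 0 R, ENNReal.ofReal (freqDensity a (dz ψ) n r)
      ≤ 400 * ∫⁻ r in Ioo 0 R, ENNReal.ofReal (freqSq a (source (dz ψ)) n r) := by
  have hμ : 0 ≤ (Real.pi * n / a) ^ 2 := sq_nonneg _
  have hna : Real.pi * n / a * a = n * Real.pi := by field_simp
  have split : ∀ {f g : ℝ → ℝ}, ContinuousOn f (Ioo 0 R) → (∀ r ∈ Ioo 0 R, 0 ≤ f r) →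
      (∀ r ∈ Ioo 0 R, 0 ≤ g r) →
      ∫⁻ r in Ioo 0 R, ENNReal.ofReal ((2 * a)⁻¹ * (f r + g r))
        = ENNReal.ofReal (2 * a)⁻¹ * (∫⁻ r in Ioo 0 R, ENNReal.ofReal (f r))
          + ENNReal.ofReal (2 * a)⁻¹ * ∫⁻ r in Ioo 0 R, ENNReal.ofReal (g r) := by
    intro f g hf hf0 hg0
    rw [← mul_add, ← lintegral_add_left' (hf.aemeasurable measurableSet_Ioo).ennreal_ofReal,
      ← lintegral_const_mul' _ _ ENNReal.ofReal_ne_top]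
    refine setLIntegral_congr_fun measurableSet_Ioo fun r hr => ?_
    rw [ENNReal.ofReal_mul (by positivity), ENNReal.ofReal_add (hf0 r hr) (hg0 r hr)]
  have bcos := lintegral_mode_le hR ha h h0 hμ (χ := fun z => Real.cos (Real.pi * n / a * z))
    (χ' := fun z => -Real.sin (Real.pi * n / a * z) * (Real.pi * n / a))
    (fun z => by simpa using ((hasDerivAt_id z).const_mul (Real.pi * n / a)).cos)
    (fun z => by
      have := (((hasDerivAt_id z).const_mul (Real.pi * n / a)).sin.neg).mul_const
        (Real.pi * n / a)
      refine this.congr_deriv ?_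
      simp only [id]
      ring)
    (by simp) (by simp [hna]) hu
  have bsin := lintegral_mode_le hR ha h h0 hμ (χ := fun z => Real.sin (Real.pi * n / a * z))
    (χ' := fun z => Real.cos (Real.pi * n / a * z) * (Real.pi * n / a))
    (fun z => by simpa using ((hasDerivAt_id z).const_mul (Real.pi * n / a)).sin)
    (fun z => by
      have := (((hasDerivAt_id z).const_mul (Real.pi * n / a)).cos).mul_const
        (Real.pi * n / a)
      refine this.congr_deriv ?_
      simp only [id]
      ring)
    (by simp [hna]) (by simp) hu
  have cs := continuousOn_source hu
  simp only [freqDensity, freqSq]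
  rw [split (continuousOn_density_mode ha (by fun_prop) hu) (fun r hr => density_nonneg hμ hr.1.le _ _ _)
    (fun r hr => density_nonneg hμ hr.1.le _ _ _),
    split (continuousOn_mode_sq (by fun_prop) cs) (fun r hr => mul_nonneg (sq_nonneg _) hr.1.le)
    (fun r hr => mul_nonneg (sq_nonneg _) hr.1.le), mul_add, mul_left_comm,
    mul_left_comm (400 : ℝ≥0∞)]
  exact add_le_add (mul_le_mul_right bcos _) (mul_le_mul_right bsin _)

end Estimate

end StreamFunction

open StreamFunction in
theorem lemma3p3 :
    ∃ c : ℝ≥0, ∀ (R a : ℝ), 0 < R → 0 < a → ∀ (ψ ω : ℝ × ℝ → ℝ),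
      IsRegularSolution R a ψ ω →
      (∀ z : ℝ, ψ (0, z) = 0) →
      integralOmega R a (fun p => dz (dz ψ) p ^ 2 / p.1 ^ 2)
        + integralOmega R a (fun p => dr (dr (dz ψ)) p ^ 2 + dr (dz ψ) p ^ 2 / p.1 ^ 2
            + dz ψ p ^ 2 / p.1 ^ 4)
        ≤ (c : ℝ≥0∞) * integralOmega R a (fun p => dz ω p ^ 2) := by
  refine ⟨400, fun R a hR ha ψ ω h h0 => ?_⟩
  have hS := isOpen_strip R
  have hΩ : IsOpen (Omega R a) := isOpen_Ioo.prod isOpen_Ioo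
  have hΩS : Omega R a ⊆ Ioo 0 R ×ˢ univ := prod_mono le_rfl (subset_univ _)
  have hψ3 : ContDiffOn ℝ ((2 : ℕ) + 1) ψ (Ioo 0 R ×ˢ univ) := by
    have := h.contDiffOn; norm_num; exact this
  have hψ2 : ContDiffOn ℝ 2 ψ (Ioo 0 R ×ˢ univ) := h.contDiffOn.of_le (by norm_num)
  have hu : ContDiffOn ℝ 2 (dz ψ) (Ioo 0 R ×ˢ univ) := contDiffOn_dz hS hψ3
  have hur : ContDiffOn ℝ 2 (dr ψ) (Ioo 0 R ×ˢ univ) := contDiffOn_dr hS hψ3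
  have hper : ∀ r ∈ Ioo 0 R, ∀ z, dz ψ (r, z + 2 * a) = dz ψ (r, z) :=
    fun r hr => dz_periodic (h.periodic r (Ioo_subset_Icc_self hr))
  obtain ⟨h1, h2, h3, h4⟩ := contDiffOn_derivs hu
  -- Differentiating the equation in `z`.
  have hω : EqOn (dz ω) (source (dz ψ)) (Omega R a) := by
    intro p hp
    have hpS := hΩS hp
    obtain ⟨k1, k2, k3, k4⟩ := contDiffOn_derivs hψ2
    obtain ⟨l1, l2, l3, l4⟩ := contDiffOn_derivs hur
    have one : ∀ {f : ℝ × ℝ → ℝ}, ContDiffOn ℝ 1 f (Ioo 0 R ×ˢ univ) →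
        HasDerivAt (fun s => f (p.1, s)) (dz f p) p.2 := fun hf =>
      hasDerivAt_dz ((hf.contDiffAt (hS.mem_nhds hpS)).differentiableAt (by norm_num))
    have hd := (((one l1).neg).sub (one h2)).sub ((one k1).const_mul (3 / p.1))
    have e1 : dz ω p = dz (fun q => -dr (dr ψ) q - dz (dz ψ) q - 3 / q.1 * dr ψ q) p :=
      dz_congr hΩ (fun q hq => (h.equation q hq).symm) hp
    have e2 : dz (dr (dr ψ)) p = dr (dr (dz ψ)) p := by
      rw [dz_dr_comm hS hur hpS]
      exact dr_congr hS (dz_dr_comm hS hψ2) hpS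
    rw [e1, source, ← e2, ← dz_dr_comm hS hψ2 hpS]
    exact hd.deriv
  have cA : ContinuousOn (fun p => dz (dz ψ) p ^ 2 / p.1 ^ 2) (Ioo 0 R ×ˢ univ) :=
    continuousOn_div_fst_pow 2 (h2.continuousOn.pow 2)
  have cB : ContinuousOn (fun p => dr (dr (dz ψ)) p ^ 2 + dr (dz ψ) p ^ 2 / p.1 ^ 2
      + dz ψ p ^ 2 / p.1 ^ 4) (Ioo 0 R ×ˢ univ) :=
    ((h3.pow 2).add (continuousOn_div_fst_pow 2 (h1.continuousOn.pow 2))).add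
      (continuousOn_div_fst_pow 4 (hu.continuousOn.pow 2))
  have mΩ : MeasurableSet (Omega R a) := hΩ.measurableSet
  have hL : integralOmega R a (fun p => dz (dz ψ) p ^ 2 / p.1 ^ 2)
        + integralOmega R a (fun p => dr (dr (dz ψ)) p ^ 2 + dr (dz ψ) p ^ 2 / p.1 ^ 2
            + dz ψ p ^ 2 / p.1 ^ 4)
      = ∫⁻ p in Omega R a, ENNReal.ofReal ((dz (dz ψ) p ^ 2 / p.1 ^ 2 + (dr (dr (dz ψ)) p ^ 2
          + dr (dz ψ) p ^ 2 / p.1 ^ 2 + dz ψ p ^ 2 / p.1 ^ 4)) * p.1) := by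
    unfold integralOmega
    have hm : AEMeasurable (fun p : ℝ × ℝ => ENNReal.ofReal (dz (dz ψ) p ^ 2 / p.1 ^ 2 * p.1))
        (volume.restrict (Omega R a)) :=
      (((cA.mono hΩS).mul continuousOn_fst).aemeasurable mΩ).ennreal_ofReal
    rw [← lintegral_add_left' hm]
    refine setLIntegral_congr_fun mΩ fun p hp => ?_
    have hp0 : 0 < p.1 := hp.1.1
    simp only
    rw [← ENNReal.ofReal_add (by positivity) (by positivity), ← add_mul]
  have hRHS : integralOmega R a (fun p => dz ω p ^ 2)
      = ∫⁻ p in Omega R a, ENNReal.ofReal (source (dz ψ) p ^ 2 * p.1) :=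
    setLIntegral_congr_fun mΩ fun p hp => by simp only [hω hp]
  have cs := continuousOn_source hu
  rw [hL, hRHS, lintegral_Omega_eq_tsum ha (T := fun p => (dz (dz ψ) p ^ 2 / p.1 ^ 2
        + (dr (dr (dz ψ)) p ^ 2 + dr (dz ψ) p ^ 2 / p.1 ^ 2 + dz ψ p ^ 2 / p.1 ^ 4)) * p.1)
      ((cA.add cB).mul continuousOn_fst) (fun p hp => mul_nonneg (by positivity) hp.1.1.le)
      (continuousOn_freqDensity ha hu) (fun n r hr => freqDensity_nonneg ha n hr.1.le)
      (fun r hr => hasSum_freqDensity ha hu hr (hper r hr)),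
    lintegral_Omega_eq_tsum ha (T := fun p => source (dz ψ) p ^ 2 * p.1)
      ((cs.pow 2).mul continuousOn_fst) (fun p hp => mul_nonneg (sq_nonneg _) hp.1.1.le)
      (continuousOn_freqSq cs) (fun n r hr => freqSq_nonneg ha n hr.1.le)
      (fun r hr => hasSum_freqSq ha cs hr), ← ENNReal.tsum_mul_left]
  exact ENNReal.tsum_le_tsum fun n => lintegral_freqDensity_le hR ha h h0 hu n
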